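/- Let $R$ be a von Neumann algebra acting on a complex Hilbert space $H$, and let $P(R)$ be the complete lattice of (orthogonal) projections in $R$, where $P\le Q$ means $PH\subseteq QH$. A nonempty subset $J\subseteq P(R)$ is called a dual ideal if $0\notin J$, if $P,Q\in J$ implies $P\wedge Q\in J$, and if $P\in J$, $P\le Q$ implies $Q\in J$. Let $D(R)$ be the set of all dual ideals of $P(R)$, with the topology generated by the sets $\{J\in D(R) : P\in J\}$, $P\in P(R)$. For a self-adjoint $A\in R$ with spectral family $(E^A_\lambda)_{\lambda\in\mathbb R}$, where $E^A_\lambda$ is the spectral projection of $A$ for $(-\infty,\lambda]$, define $f_A : D(R)\to\mathbb R$ by $$f_A(J)=\inf\{\lambda\in\mathbb R : E^A_\lambda\in J\}.$$ A function $f : D(R)\to\mathbb R$ is called an abstract observable function if it is upper semicontinuous and if $f\bigl(\bigcap_{k} J_k\bigr)=\sup_{k} f(J_k)$ for every nonempty family $(J_k)_k$ in $D(R)$. Then $f_A$ is an abstract observable function for every self-adjoint $A\in R$, and for every abstract observable function $f : D(R)\to\mathbb R$ there is a unique self-adjoint $A\in R$ with $f=f_A$. Thus $A\mapsto f_A$ is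 a bijection from the self-adjoint elements of $R$ onto the abstract observable functions on $D(R)$. -/

import Mathlib

namespace VonNeumannAlgebra

universe u

/-- The projections (self-adjoint idempotents) belonging to a von Neumann algebra `R`. -/
structure Proj {H : Type u} [NormedAddCommGroup H] [InnerProductSpace ℂ H] [CompleteSpace H]
    (R : VonNeumannAlgebra H) where
  op : H →L[ℂ] H
  isStarProjection : IsStarProjection op
  mem : op ∈ R

/-- The self-adjoint elements of a von Neumann algebra `R`. -/
structure SelfAdj {H : Type u} [NormedAddCommGroup H] [InnerProductSpace ℂ H] [CompleteSpace H]
    (R : VonNeumannAlgebra H) where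
  op : H →L[ℂ] H
  isSelfAdjoint : IsSelfAdjoint op
  mem : op ∈ R

section

variable {H : Type u} [NormedAddCommGroup H] [InnerProductSpace ℂ H] [CompleteSpace H]
  {R : VonNeumannAlgebra H}

theorem Proj.range_injective :
    Function.Injective (fun P : Proj R => (P.op.range : Submodule ℂ H)) := by
  intro P Q h
  have h2 : P.op = Q.op :=
    ContinuousLinearMap.IsStarProjection.ext P.isStarProjection Q.isStarProjection h
  cases P
  cases Q
  simpa using h2

/-- Projections are ordered by inclusion of their ranges. -/
instance Proj.instPartialOrder : PartialOrder (Proj R) :=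
  PartialOrder.lift (fun P : Proj R => (P.op.range : Submodule ℂ H)) Proj.range_injective

theorem Proj.le_def {P Q : Proj R} :
    P ≤ Q ↔ (P.op.range : Submodule ℂ H) ≤ Q.op.range := Iff.rfl

theorem starProjection_mem (U : Submodule ℂ H) [U.HasOrthogonalProjection]
    (hU : ∀ y ∈ R.commutant, ∀ x ∈ U, y x ∈ U) : U.starProjection ∈ R := by
  rw [VonNeumannAlgebra.IsStarProjection.mem_iff isStarProjection_starProjection]
  intro y hy
  rw [Submodule.range_starProjection]
  exact fun x hx => hU y hy x hx

theorem Proj.isClosed_range (P : Proj R) : IsClosed ((P.op.range : Submodule ℂ H) : Set H) :=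
  ContinuousLinearMap.IsIdempotentElem.isClosed_range P.isStarProjection.isIdempotentElem

theorem Proj.completeSpace_iInf_range (S : Set (Proj R)) :
    CompleteSpace (⨅ P ∈ S, (P.op.range : Submodule ℂ H) : Submodule ℂ H) := by
  have h : IsClosed ((⨅ P ∈ S, (P.op.range : Submodule ℂ H) : Submodule ℂ H) : Set H) := by
    simp only [Submodule.coe_iInf]
    exact isClosed_biInter fun P _ => P.isClosed_range
  exact h.completeSpace_coe

/-- The infimum of a set of projections in `R` is the orthogonal projection onto the intersection
of their ranges. -/
noncomputable instance Proj.instInfSet : InfSet (Proj R) where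
  sInf S :=
    haveI := Proj.completeSpace_iInf_range S
    { op := (⨅ P ∈ S, (P.op.range : Submodule ℂ H) : Submodule ℂ H).starProjection
      isStarProjection := isStarProjection_starProjection
      mem := by
        apply starProjection_mem
        intro y hy x hx
        simp only [Submodule.mem_iInf] at hx ⊢
        intro P hP
        exact (VonNeumannAlgebra.IsStarProjection.mem_iff P.isStarProjection R).1 P.mem y hy
          (hx P hP) }

theorem Proj.range_sInf (S : Set (Proj R)) :
    ((sInf S).op.range : Submodule ℂ H) = ⨅ P ∈ S, (P.op.range : Submodule ℂ H) := by
  have := Proj.completeSpace_iInf_range S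
  exact Submodule.range_starProjection _

theorem Proj.isGLB_sInf (S : Set (Proj R)) : IsGLB S (sInf S) := by
  constructor
  · intro P hP
    rw [Proj.le_def, Proj.range_sInf]
    exact iInf₂_le P hP
  · intro Q hQ
    rw [Proj.le_def, Proj.range_sInf]
    exact le_iInf₂ fun P hP => hQ hP

/-- The zero projection. -/
instance Proj.instZero : Zero (Proj R) := ⟨⟨0, .zero _, zero_mem R⟩⟩

/-- The identity operator as a projection. -/
instance Proj.instOne : One (Proj R) := ⟨⟨1, .one _, one_mem R⟩⟩

/-- The projection lattice of `R` is a complete lattice, with bottom `0` and top `1`. -/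
noncomputable instance Proj.instCompleteLattice : CompleteLattice (Proj R) where
  bot := 0
  bot_le P := by
    rw [Proj.le_def]
    rintro _ ⟨x, rfl⟩
    exact zero_mem _
  top := 1
  le_top P := by
    rw [Proj.le_def]
    exact fun x _ => ⟨x, rfl⟩
  __ := completeLatticeOfInf (Proj R) Proj.isGLB_sInf

/-- The spectral family `lam ↦ E_lam` of a self-adjoint `A ∈ R`: `E_lam` is the spectral projection
of `A` for `(-∞, lam]`, that is, the orthogonal projection onto the kernel of the positive part
`(A - lam)⁺`, which is given by the continuous functional calculus. -/
noncomputable def SelfAdj.spectralFamily (A : SelfAdj R) (lam : ℝ) : Proj R where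
  op := ((cfc (fun t : ℝ => max (t - lam) 0) A.op).ker : Submodule ℂ H).starProjection
  isStarProjection := isStarProjection_starProjection
  mem := by
    apply starProjection_mem
    intro y hy x hx
    have hc : Commute A.op y := VonNeumannAlgebra.mem_commutant_iff.1 hy _ A.mem
    have h := congrArg (fun T : H →L[ℂ] H => T x)
      (hc.cfc_real (fun t : ℝ => max (t - lam) 0)).eq
    simp only [LinearMap.mem_ker] at hx ⊢
    simp only [mul_apply_eq_comp] at h
    have hx' : (cfc (fun t : ℝ => max (t - lam) 0) A.op) x = 0 := hx
    change (cfc (fun t : ℝ => max (t - lam) 0) A.op) (y x) = 0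
    rw [h, hx', map_zero]

end

end VonNeumannAlgebra

/-- A dual ideal of a complete lattice: a nonempty subset which does not contain the bottom
element, is closed under binary meets, and is upward closed. -/
@[ext]
structure DualIdeal (L : Type*) [CompleteLattice L] where
  carrier : Set L
  nonempty : carrier.Nonempty
  bot_notMem : ⊥ ∉ carrier
  inf_mem : ∀ a ∈ carrier, ∀ b ∈ carrier, a ⊓ b ∈ carrier
  mem_of_le : ∀ a ∈ carrier, ∀ b, a ≤ b → b ∈ carrier

namespace DualIdeal

section

variable {L : Type*} [CompleteLattice L]

instance instMembership : Membership L (DualIdeal L) := ⟨fun J a => a ∈ J.carrier⟩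

theorem top_mem (J : DualIdeal L) : ⊤ ∈ J.carrier := by
  obtain ⟨a, ha⟩ := J.nonempty
  exact J.mem_of_le a ha ⊤ le_top

/-- The intersection of a nonempty set of dual ideals. -/
def inter (S : Set (DualIdeal L)) (hS : S.Nonempty) : DualIdeal L where
  carrier := {a | ∀ J ∈ S, a ∈ J}
  nonempty := ⟨⊤, fun J _ => J.top_mem⟩
  bot_notMem h := by
    obtain ⟨J, hJ⟩ := hS
    exact J.bot_notMem (h J hJ)
  inf_mem a ha b hb J hJ := J.inf_mem a (ha J hJ) b (hb J hJ)
  mem_of_le a ha b hab J hJ := J.mem_of_le a (ha J hJ) b hab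

/-- The topology on the space of dual ideals generated by the sets `{J | a ∈ J}`, `a ∈ L`. -/
instance instTopologicalSpace : TopologicalSpace (DualIdeal L) :=
  TopologicalSpace.generateFrom {U | ∃ a : L, U = {J : DualIdeal L | a ∈ J}}

/-- An abstract observable function is an upper semicontinuous function that turns intersections of
nonempty families of dual ideals into suprema. (A family enters only through the set of its
members; the supremum is taken in `ℝ`, so that it exists is part of the condition.) -/
structure IsAbstractObservable (f : DualIdeal L → ℝ) : Prop where
  upperSemicontinuous : UpperSemicontinuous f
  isLUB_inter : ∀ (S : Set (DualIdeal L)) (hS : S.Nonempty), IsLUB (f '' S) (f (inter S hS))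

end

end DualIdeal

namespace VonNeumannAlgebra

/-- The observable function `f_A` of a self-adjoint `A ∈ R`, on the dual ideals of the projection
lattice of `R`: `f_A(J) = inf {lam | E_lam ∈ J}`. -/
noncomputable def SelfAdj.observableFunction {H : Type*} [NormedAddCommGroup H]
    [InnerProductSpace ℂ H] [CompleteSpace H] {R : VonNeumannAlgebra H} (A : SelfAdj R)
    (J : DualIdeal (Proj R)) : ℝ :=
  sInf {lam : ℝ | A.spectralFamily lam ∈ J}

end VonNeumannAlgebra

/-! The proof splits into a lattice half and an operator half, joined by bounded right continuous
families `E`.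

In any complete lattice, the function of such a family satisfies `f (principal a) ≤ s` iff `a ≤ E
s`, so it determines `E`. Conversely, let `E s` be the supremum of all `a` with `f (principal a) ≤
s`. The intersection axiom shows that this supremum again has value at most `s` if it is nonzero
(`le_levelSup_iff`), and semicontinuity makes `f J` the infimum of `f (principal a)` over `a ∈ J`,
so `f` is recovered from `E` (`lowerCut_levelSup`).

On the operator side, `Cuts E A` expresses that `A` is at most `s` on `E s` and at least `s` on its
complement. This determines `A` as the norm limit of Stieltjes sums of `E` (`tendsto_dyadicSum`),
and determines a right continuous `E` by interlacing (`Cuts.mul_eq_left`). Those sums converge for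
every bounded family, and the double commutant theorem puts the limit in `R`. -/

namespace DualIdeal

section

variable {L : Type*} [CompleteLattice L]

/-! ### Dual ideals and bounded families in a complete lattice -/

theorem mem_carrier {J : DualIdeal L} {a : L} : a ∈ J.carrier ↔ a ∈ J := Iff.rfl

theorem mem_inter {S : Set (DualIdeal L)} {hS : S.Nonempty} {a : L} :
    a ∈ inter S hS ↔ ∀ J ∈ S, a ∈ J := Iff.rfl

theorem isOpen_setOf_mem (a : L) : IsOpen {J : DualIdeal L | a ∈ J} :=
  TopologicalSpace.isOpen_generateFrom_of_mem ⟨a, rfl⟩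

/-- The dual ideal of all elements above a nonzero element. -/
def principal (a : L) (ha : a ≠ ⊥) : DualIdeal L where
  carrier := Set.Ici a
  nonempty := ⟨a, le_rfl⟩
  bot_notMem h := ha (le_bot_iff.1 h)
  inf_mem _ hb _ hc := le_inf hb hc
  mem_of_le _ hb _ hc := le_trans hb hc

theorem mem_principal {a b : L} {ha : a ≠ ⊥} : b ∈ principal a ha ↔ a ≤ b := Iff.rfl

/-- The generating sets for `a` and `b` meet in the one for `a ⊓ b`, so they form a base. -/
theorem mem_of_mem_nhds {J : DualIdeal L} {U : Set (DualIdeal L)} (hU : U ∈ nhds J) :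
    ∃ a ∈ J, ∀ K : DualIdeal L, a ∈ K → K ∈ U := by
  have key : ∀ V : Set (DualIdeal L),
      TopologicalSpace.GenerateOpen {U | ∃ a : L, U = {J : DualIdeal L | a ∈ J}} V →
      J ∈ V → ∃ a ∈ J, ∀ K : DualIdeal L, a ∈ K → K ∈ V := by
    intro V hV
    induction hV with
    | basic s hs =>
      obtain ⟨a, rfl⟩ := hs
      exact fun h => ⟨a, h, fun K hK => hK⟩
    | univ => exact fun _ => ⟨⊤, J.top_mem, fun K _ => trivial⟩
    | inter s t _ _ hs ht =>
      rintro ⟨h1, h2⟩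
      obtain ⟨a, ha, ha'⟩ := hs h1
      obtain ⟨b, hb, hb'⟩ := ht h2
      exact ⟨a ⊓ b, J.inf_mem a ha b hb, fun K hK =>
        ⟨ha' K (K.mem_of_le _ hK a inf_le_left), hb' K (K.mem_of_le _ hK b inf_le_right)⟩⟩
    | sUnion S _ ih =>
      rintro ⟨s, hs, hJ⟩
      obtain ⟨a, ha, ha'⟩ := ih s hs hJ
      exact ⟨a, ha, fun K hK => ⟨s, hs, ha' K hK⟩⟩
  obtain ⟨V, hVU, hV, hJ⟩ := mem_nhds_iff.1 hU
  obtain ⟨a, ha, ha'⟩ := key V hV hJ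
  exact ⟨a, ha, fun K hK => hVU (ha' K hK)⟩

/-- A right continuous monotone map from the real line which is `⊥` far to the left and `⊤` far to
the right. -/
structure IsBoundedSpectralFamily (E : ℝ → L) : Prop where
  mono : Monotone E
  le_of_forall_gt : ∀ s c, (∀ t, s < t → c ≤ E t) → c ≤ E s
  exists_eq_bot : ∃ a, E a = ⊥
  exists_eq_top : ∃ b, E b = ⊤

/-- The function on dual ideals attached to a family of lattice elements. -/
noncomputable def lowerCut (E : ℝ → L) (J : DualIdeal L) : ℝ := sInf {s : ℝ | E s ∈ J}

namespace IsBoundedSpectralFamily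

variable {E F : ℝ → L}

theorem nonempty_setOf_mem (hE : IsBoundedSpectralFamily E) (J : DualIdeal L) :
    {s : ℝ | E s ∈ J}.Nonempty := by
  obtain ⟨b, hb⟩ := hE.exists_eq_top
  refine ⟨b, ?_⟩
  rw [Set.mem_ofPred_eq, hb]
  exact J.top_mem

theorem bddBelow_setOf_mem (hE : IsBoundedSpectralFamily E) (J : DualIdeal L) :
    BddBelow {s : ℝ | E s ∈ J} := by
  obtain ⟨a, ha⟩ := hE.exists_eq_bot
  refine ⟨a, fun s hs => ?_⟩
  by_contra! h
  exact J.bot_notMem (ha ▸ J.mem_of_le _ hs _ (hE.mono h.le))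

theorem lowerCut_le (hE : IsBoundedSpectralFamily E) {J : DualIdeal L} {s : ℝ} (h : E s ∈ J) :
    lowerCut E J ≤ s :=
  csInf_le (hE.bddBelow_setOf_mem J) h

theorem mem_of_lowerCut_lt (hE : IsBoundedSpectralFamily E) {J : DualIdeal L} {s : ℝ}
    (h : lowerCut E J < s) : E s ∈ J := by
  obtain ⟨t, ht, hts⟩ := exists_lt_of_csInf_lt (hE.nonempty_setOf_mem J) h
  exact J.mem_of_le _ ht _ (hE.mono hts.le)

theorem isAbstractObservable_lowerCut (hE : IsBoundedSpectralFamily E) :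
    IsAbstractObservable (lowerCut E) where
  upperSemicontinuous J c hc := by
    obtain ⟨s, hs, hsc⟩ := exists_between hc
    filter_upwards [(isOpen_setOf_mem (E s)).mem_nhds (hE.mem_of_lowerCut_lt hs)] with K hK
    exact (hE.lowerCut_le hK).trans_lt hsc
  isLUB_inter S hS := by
    constructor
    · rintro _ ⟨J, hJ, rfl⟩
      exact csInf_le_csInf (hE.bddBelow_setOf_mem J) (hE.nonempty_setOf_mem _)
        fun s hs => (mem_inter (hS := hS)).1 hs J hJ
    · intro c hc
      refine le_of_forall_gt_imp_ge_of_dense fun s hs => hE.lowerCut_le ?_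
      exact mem_inter.2 fun J hJ => hE.mem_of_lowerCut_lt ((hc ⟨J, hJ, rfl⟩).trans_lt hs)

/-- Right continuity is what makes the infimum attained on a principal dual ideal. -/
theorem lowerCut_principal_le_iff (hE : IsBoundedSpectralFamily E) {a : L} (ha : a ≠ ⊥) {s : ℝ} :
    lowerCut E (principal a ha) ≤ s ↔ a ≤ E s :=
  ⟨fun h => hE.le_of_forall_gt s a fun _ ht =>
      mem_principal.1 (hE.mem_of_lowerCut_lt (h.trans_lt ht)),
    fun h => hE.lowerCut_le (mem_principal.2 h)⟩

theorem eq_of_lowerCut_eq (hE : IsBoundedSpectralFamily E) (hF : IsBoundedSpectralFamily F)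
    (h : lowerCut E = lowerCut F) : E = F := by
  funext s
  refine eq_of_forall_le_iff fun a => ?_
  by_cases ha : a = ⊥
  · simp [ha]
  · rw [← hE.lowerCut_principal_le_iff ha, ← hF.lowerCut_principal_le_iff ha, h]

end IsBoundedSpectralFamily

/-! ### From abstract observable functions to bounded families -/

namespace IsAbstractObservable

variable {f : DualIdeal L → ℝ}

/-- Here `J ∩ K = J`, so `f J` is the supremum of `f J` and `f K`. -/
theorem antitone (hf : IsAbstractObservable f) {J K : DualIdeal L} (h : ∀ a ∈ J, a ∈ K) :
    f K ≤ f J := by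
  have h1 : inter {J, K} (Set.insert_nonempty _ _) = J := by
    ext a
    simp only [mem_carrier, mem_inter]
    exact ⟨fun ha => ha J (by simp), by rintro ha _ (rfl | rfl); exacts [ha, h a ha]⟩
  have h2 := (hf.isLUB_inter {J, K} (Set.insert_nonempty _ _)).1 ⟨K, by simp, rfl⟩
  rwa [h1] at h2

theorem exists_principal_lt (hf : IsAbstractObservable f) {J : DualIdeal L} {c : ℝ}
    (h : f J < c) : ∃ a, ∃ ha : a ≠ ⊥, a ∈ J ∧ f (principal a ha) < c := by
  obtain ⟨a, ha, hK⟩ := mem_of_mem_nhds (hf.upperSemicontinuous J c h)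
  exact ⟨a, fun h0 => J.bot_notMem (h0 ▸ ha), ha, hK _ (mem_principal.2 le_rfl)⟩

/-- The supremum of the elements whose principal dual ideal has value at most `s`. -/
def levelSup (f : DualIdeal L → ℝ) (s : ℝ) : L :=
  sSup {a | ∃ ha : a ≠ ⊥, f (principal a ha) ≤ s}

/-- Intersecting the principal dual ideals of all admissible elements leaves only elements above
their supremum, and the intersection axiom bounds `f` there by `s`. -/
theorem le_levelSup_iff (hf : IsAbstractObservable f) {a : L} (ha : a ≠ ⊥) {s : ℝ} :
    a ≤ levelSup f s ↔ f (principal a ha) ≤ s := by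
  refine ⟨fun h => ?_, fun h => le_sSup ⟨ha, h⟩⟩
  set S : Set (DualIdeal L) := {J | ∃ b, ∃ hb : b ≠ ⊥, J = principal b hb ∧ f J ≤ s}
  have hne : S.Nonempty := by
    by_contra hemp
    have : {a | ∃ ha : a ≠ ⊥, f (principal a ha) ≤ s} = ∅ := by
      ext b
      simp only [Set.mem_ofPred_eq, Set.mem_empty_iff_false, iff_false]
      rintro ⟨hb, hb'⟩
      exact hemp ⟨_, b, hb, rfl, hb'⟩
    rw [levelSup, this, sSup_empty] at h
    exact ha (le_bot_iff.1 h)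
  have h1 : f (inter S hne) ≤ s := by
    refine (hf.isLUB_inter S hne).2 ?_
    rintro _ ⟨J, ⟨b, hb, -, hJ⟩, rfl⟩
    exact hJ
  refine (hf.antitone fun c hc => ?_).trans h1
  refine mem_principal.2 (h.trans (sSup_le ?_))
  rintro b ⟨hb, hb'⟩
  exact mem_principal.1 (mem_inter.1 hc _ ⟨b, hb, rfl, hb'⟩)

theorem monotone_levelSup : Monotone (levelSup f) := fun _ _ hst =>
  sSup_le_sSup fun _ ⟨ha, h⟩ => ⟨ha, h.trans hst⟩

theorem isBoundedSpectralFamily_levelSup (hf : IsAbstractObservable f) :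
    IsBoundedSpectralFamily (levelSup f) where
  mono := monotone_levelSup
  le_of_forall_gt s c h := by
    by_cases hc : c = ⊥
    · simp [hc]
    · rw [hf.le_levelSup_iff hc]
      exact le_of_forall_gt_imp_ge_of_dense fun t ht => (hf.le_levelSup_iff hc).1 (h t ht)
  exists_eq_bot := by
    -- Otherwise the levels generate a dual ideal `J` containing the principal one of every level,
    -- so `f J ≤ s` for all `s`; taking `s = f J - 1` is absurd.
    by_contra! hne
    let J : DualIdeal L :=
      { carrier := {a | ∃ s, levelSup f s ≤ a}
        nonempty := ⟨⊤, 0, le_top⟩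
        bot_notMem := fun ⟨s, hs⟩ => hne s (le_bot_iff.1 hs)
        inf_mem := fun a ⟨s, hs⟩ b ⟨t, ht⟩ => ⟨min s t, le_inf
          ((monotone_levelSup (min_le_left s t)).trans hs)
          ((monotone_levelSup (min_le_right s t)).trans ht)⟩
        mem_of_le := fun a ⟨s, hs⟩ b hab => ⟨s, hs.trans hab⟩ }
    have h1 : f J ≤ f J - 1 :=
      (hf.antitone (J := principal (levelSup f (f J - 1)) (hne _)) (K := J)
        fun a ha => ⟨_, mem_principal.1 ha⟩).trans ((hf.le_levelSup_iff (hne _)).1 le_rfl)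
    linarith
  exists_eq_top := by
    by_cases h : (⊤ : L) = ⊥
    · exact ⟨0, top_le_iff.1 (h.le.trans bot_le)⟩
    · exact ⟨f (principal ⊤ h), top_le_iff.1 ((hf.le_levelSup_iff h).2 le_rfl)⟩

theorem lowerCut_levelSup (hf : IsAbstractObservable f) : lowerCut (levelSup f) = f := by
  funext J
  have hE := hf.isBoundedSpectralFamily_levelSup
  refine le_antisymm (le_of_forall_gt_imp_ge_of_dense fun s hs => ?_)
    (le_csInf (hE.nonempty_setOf_mem J) fun s hs => ?_)
  · obtain ⟨a, ha, haJ, has⟩ := hf.exists_principal_lt hs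
    exact hE.lowerCut_le (J.mem_of_le _ haJ _ ((hf.le_levelSup_iff ha).2 has.le))
  · have h0 : levelSup f s ≠ ⊥ := fun h0 => J.bot_notMem (h0 ▸ hs)
    exact (hf.antitone fun a ha => J.mem_of_le _ hs _ (mem_principal.1 ha)).trans
      ((hf.le_levelSup_iff h0).1 le_rfl)

end IsAbstractObservable

end

end DualIdeal

/-! ### Stieltjes sums in a C*-algebra -/

namespace CStarAlgebra

/-- A spectral resolution of the identity supported on `[a, b]`: a commuting increasing family of
projections. -/
structure IsResolution {𝔄 : Type*} [CStarAlgebra 𝔄] (E : ℝ → 𝔄) (a b : ℝ) : Prop where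
  isStarProjection : ∀ s, IsStarProjection (E s)
  mul_eq : ∀ s t, E s * E t = E (min s t)
  eq_zero : E a = 0
  eq_one : E b = 1

/-- A projection-valued family is compatible with an element if it cuts it at each level. -/
structure Cuts {𝔄 : Type*} [CStarAlgebra 𝔄] [PartialOrder 𝔄] (E : ℝ → 𝔄) (A : 𝔄) : Prop where
  commute : ∀ s, Commute A (E s)
  mul_le : ∀ s, A * E s ≤ s • E s
  le_mul : ∀ s, s • (1 - E s) ≤ A * (1 - E s)

/-- The points of the `n`-th dyadic subdivision of `[a, b]`. -/
noncomputable def dyadicNode (a b : ℝ) (n i : ℕ) : ℝ := a + (b - a) * (i / 2 ^ n)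

/-- Lower Riemann-Stieltjes sums of the identity function for dyadic subdivisions. -/
noncomputable def dyadicSum {𝔄 : Type*} [CStarAlgebra 𝔄] (E : ℝ → 𝔄) (a b : ℝ) (n : ℕ) : 𝔄 :=
  ∑ i ∈ Finset.range (2 ^ n),
    dyadicNode a b n i • (E (dyadicNode a b n (i + 1)) - E (dyadicNode a b n i))

section

variable {a b : ℝ}

theorem dyadicNode_zero (n : ℕ) : dyadicNode a b n 0 = a := by simp [dyadicNode]

theorem dyadicNode_last (n : ℕ) : dyadicNode a b n (2 ^ n) = b := by simp [dyadicNode]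

theorem dyadicNode_succ (n i : ℕ) :
    dyadicNode a b n (i + 1) = dyadicNode a b n i + (b - a) / 2 ^ n := by
  simp only [dyadicNode]; push_cast; ring

theorem dyadicNode_two_mul (n i : ℕ) : dyadicNode a b (n + 1) (2 * i) = dyadicNode a b n i := by
  simp only [dyadicNode]; push_cast; field_simp; ring

theorem dyadicNode_le_succ (hab : a ≤ b) (n i : ℕ) :
    dyadicNode a b n i ≤ dyadicNode a b n (i + 1) := by
  rw [dyadicNode_succ]
  have : 0 ≤ (b - a) / 2 ^ n := div_nonneg (sub_nonneg.2 hab) (by positivity)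
  linarith

theorem sum_range_two_mul {M : Type*} [AddCommMonoid M] (g : ℕ → M) (N : ℕ) :
    ∑ i ∈ Finset.range (2 * N), g i = ∑ i ∈ Finset.range N, (g (2 * i) + g (2 * i + 1)) := by
  induction N with
  | zero => simp
  | succ N ih =>
    rw [mul_add, mul_one, Finset.sum_range_succ, Finset.sum_range_succ, Finset.sum_range_succ, ih,
      add_assoc]

end

section

variable {𝔄 : Type*} [CStarAlgebra 𝔄] {E : ℝ → 𝔄} {A : 𝔄} {a b : ℝ}

namespace IsResolution

theorem commute (hE : IsResolution E a b) (s t : ℝ) : Commute (E s) (E t) := by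
  rw [Commute, SemiconjBy, hE.mul_eq, hE.mul_eq, min_comm]

theorem sum_increments (hE : IsResolution E a b) (n : ℕ) :
    ∑ i ∈ Finset.range (2 ^ n), (E (dyadicNode a b n (i + 1)) - E (dyadicNode a b n i)) = 1 := by
  rw [Finset.sum_range_sub (fun i => E (dyadicNode a b n i)), dyadicNode_last, dyadicNode_zero,
    hE.eq_zero, hE.eq_one, sub_zero]

theorem isSelfAdjoint_dyadicSum (hE : IsResolution E a b) (n : ℕ) :
    IsSelfAdjoint (dyadicSum E a b n) := by
  refine isSelfAdjoint_sum _ fun i _ => ?_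
  exact (IsSelfAdjoint.all _).smul
    ((hE.isStarProjection _).isSelfAdjoint.sub (hE.isStarProjection _).isSelfAdjoint)

theorem commute_dyadicSum {y : 𝔄} (hy : ∀ s, Commute (E s) y) (n : ℕ) :
    Commute (dyadicSum E a b n) y :=
  Commute.sum_left _ _ _ fun _ _ => ((hy _).sub_left (hy _)).smul_left _

/-- Halving a cell raises the coefficient on its right half from the left endpoint to the midpoint
and changes nothing on its left half. -/
theorem dyadicSum_succ_sub (n : ℕ) :
    dyadicSum E a b (n + 1) - dyadicSum E a b n = ((b - a) / 2 ^ (n + 1)) •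
      ∑ i ∈ Finset.range (2 ^ n),
        (E (dyadicNode a b n (i + 1)) - E (dyadicNode a b (n + 1) (2 * i + 1))) := by
  rw [dyadicSum, dyadicSum, pow_succ', sum_range_two_mul, ← Finset.sum_sub_distrib,
    Finset.smul_sum]
  refine Finset.sum_congr rfl fun i _ => ?_
  have h1 : dyadicNode a b (n + 1) (2 * i + 1 + 1) = dyadicNode a b n (i + 1) := by
    rw [← dyadicNode_two_mul n (i + 1), mul_add]
  rw [h1, dyadicNode_two_mul]
  have h2 := dyadicNode_succ (a := a) (b := b) (n + 1) (2 * i)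
  rw [dyadicNode_two_mul, pow_succ'] at h2
  generalize E (dyadicNode a b (n + 1) (2 * i + 1)) = x
  rw [h2]
  module

variable [PartialOrder 𝔄] [StarOrderedRing 𝔄]

theorem monotone (hE : IsResolution E a b) : Monotone E := fun s t hst => by
  rw [IsStarProjection.le_iff_mul_eq_left (hE.isStarProjection s) (hE.isStarProjection t),
    hE.mul_eq, min_eq_left hst]

theorem norm_dyadicSum_succ_sub_le (hE : IsResolution E a b) (hab : a ≤ b) (n : ℕ) :
    ‖dyadicSum E a b (n + 1) - dyadicSum E a b n‖ ≤ (b - a) / 2 ^ (n + 1) := by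
  have hd : 0 ≤ (b - a) / 2 ^ (n + 1) := div_nonneg (sub_nonneg.2 hab) (by positivity)
  rw [dyadicSum_succ_sub, norm_smul, Real.norm_of_nonneg hd]
  refine mul_le_of_le_one_right hd ?_
  have hle (i : ℕ) : dyadicNode a b (n + 1) (2 * i + 1) ≤ dyadicNode a b n (i + 1) := by
    rw [← dyadicNode_two_mul n (i + 1), mul_add]
    exact dyadicNode_le_succ hab _ _
  rw [CStarAlgebra.norm_le_one_iff_of_nonneg _
    (Finset.sum_nonneg fun i _ => sub_nonneg.2 (hE.monotone (hle i))), ← hE.sum_increments n]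
  refine Finset.sum_le_sum fun i _ => sub_le_sub_left (hE.monotone ?_) _
  rw [← dyadicNode_two_mul]
  exact dyadicNode_le_succ hab _ _

theorem exists_tendsto_dyadicSum (hE : IsResolution E a b) (hab : a ≤ b) :
    ∃ A, Filter.Tendsto (dyadicSum E a b) Filter.atTop (nhds A) := by
  refine cauchySeq_tendsto_of_complete (cauchySeq_of_le_geometric (1 / 2) ((b - a) / 2)
    (by norm_num) fun n => ?_)
  rw [dist_comm, dist_eq_norm]
  refine (hE.norm_dyadicSum_succ_sub_le hab n).trans (le_of_eq ?_)
  rw [one_div, inv_pow, pow_succ]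
  field_simp

theorem dyadicSum_mul_le (hE : IsResolution E a b) (hab : a ≤ b) (n : ℕ) (s : ℝ) :
    dyadicSum E a b n * E s ≤ s • E s := by
  have h : s • E s = ∑ i ∈ Finset.range (2 ^ n),
      s • ((E (dyadicNode a b n (i + 1)) - E (dyadicNode a b n i)) * E s) := by
    rw [← Finset.smul_sum, ← Finset.sum_mul, hE.sum_increments, one_mul]
  rw [h, dyadicSum, Finset.sum_mul]
  refine Finset.sum_le_sum fun i _ => ?_
  rw [smul_mul_assoc, sub_mul, hE.mul_eq, hE.mul_eq]
  have hi := dyadicNode_le_succ hab n i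
  rcases le_total (dyadicNode a b n i) s with h | h
  · exact smul_le_smul_of_nonneg_right h (sub_nonneg.2 (hE.monotone (min_le_min_right s hi)))
  · rw [min_eq_right h, min_eq_right (h.trans hi), sub_self, smul_zero, smul_zero]

/-- Adding the mesh turns the lower sum into the upper one; the lower sum alone can fail on the cell
containing `s`. -/
theorem le_dyadicSum_mul (hE : IsResolution E a b) (hab : a ≤ b) (n : ℕ) (s : ℝ) :
    s • (1 - E s) ≤ (dyadicSum E a b n + ((b - a) / 2 ^ n) • 1) * (1 - E s) := by
  have h : s • (1 - E s) = ∑ i ∈ Finset.range (2 ^ n),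
      s • ((E (dyadicNode a b n (i + 1)) - E (dyadicNode a b n i)) * (1 - E s)) := by
    rw [← Finset.smul_sum, ← Finset.sum_mul, hE.sum_increments, one_mul]
  have h' : dyadicSum E a b n + ((b - a) / 2 ^ n) • 1 = ∑ i ∈ Finset.range (2 ^ n),
      dyadicNode a b n (i + 1) • (E (dyadicNode a b n (i + 1)) - E (dyadicNode a b n i)) := by
    rw [← hE.sum_increments n, Finset.smul_sum, dyadicSum, ← Finset.sum_add_distrib]
    refine Finset.sum_congr rfl fun i _ => ?_
    rw [← add_smul, ← dyadicNode_succ]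
  rw [h, h', Finset.sum_mul]
  refine Finset.sum_le_sum fun i _ => ?_
  have hi := dyadicNode_le_succ hab n i
  have hc := hE.monotone hi
  rw [smul_mul_assoc]
  have hm : (E (dyadicNode a b n (i + 1)) - E (dyadicNode a b n i)) * (1 - E s) =
      E (max (dyadicNode a b n (i + 1)) s) - E (max (dyadicNode a b n i) s) := by
    have hx (t : ℝ) : E (max t s) = E t + E s - E (min t s) := by
      rcases le_total t s with h | h <;> simp [h]
    rw [mul_sub, mul_one, sub_mul, hE.mul_eq, hE.mul_eq, hx, hx]
    abel
  rw [hm]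
  rcases le_total s (dyadicNode a b n (i + 1)) with h | h
  · exact smul_le_smul_of_nonneg_right h (sub_nonneg.2 (hE.monotone (max_le_max_right s hi)))
  · rw [max_eq_right h, max_eq_right (hi.trans h), sub_self, smul_zero, smul_zero]

/-- An element that is cut by `E` is approximated by the dyadic sums of `E`. -/
theorem tendsto_dyadicSum (hE : IsResolution E a b) (hab : a ≤ b) (hA : Cuts E A) :
    Filter.Tendsto (dyadicSum E a b) Filter.atTop (nhds A) := by
  have key (n : ℕ) : ‖A - dyadicSum E a b n‖ ≤ (b - a) / 2 ^ n := by
    have hd : 0 ≤ (b - a) / 2 ^ n := div_nonneg (sub_nonneg.2 hab) (by positivity)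
    have hsum : A - dyadicSum E a b n = ∑ i ∈ Finset.range (2 ^ n),
        (A - dyadicNode a b n i • 1) *
          (E (dyadicNode a b n (i + 1)) - E (dyadicNode a b n i)) := by
      simp_rw [sub_mul, Finset.sum_sub_distrib]
      rw [← Finset.mul_sum, hE.sum_increments, mul_one, dyadicSum]
      simp
    have hterm (i : ℕ) : 0 ≤ (A - dyadicNode a b n i • 1) *
          (E (dyadicNode a b n (i + 1)) - E (dyadicNode a b n i)) ∧
        (A - dyadicNode a b n i • 1) *
          (E (dyadicNode a b n (i + 1)) - E (dyadicNode a b n i)) ≤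
        ((b - a) / 2 ^ n) • (E (dyadicNode a b n (i + 1)) - E (dyadicNode a b n i)) := by
      have hi := dyadicNode_le_succ hab n i
      have hs := dyadicNode_succ (a := a) (b := b) n i
      generalize dyadicNode a b n i = s at *
      generalize dyadicNode a b n (i + 1) = t at *
      have hst : E s * E t = E s := by rw [hE.mul_eq, min_eq_left hi]
      have hts : E t * E s = E s := by rw [hE.mul_eq, min_eq_right hi]
      have htt : E t * E t = E t := by rw [hE.mul_eq, min_self]
      have hss : E s * E s = E s := by rw [hE.mul_eq, min_self]
      have hct : E t * A = A * E t := (hA.commute t).eq.symm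
      have hcs' (x : 𝔄) : E s * (A * x) = A * (E s * x) := by
        rw [← mul_assoc, ← hA.commute s, mul_assoc]
      have hct' (x : 𝔄) : E t * (A * x) = A * (E t * x) := by rw [← mul_assoc, hct, mul_assoc]
      constructor
      -- The increment is `E t * (1 - E s)`: compress the lower bound at `s` by `E t`, and below it
      -- the upper bound at `t` by `1 - E s`.
      · have h1 := IsSelfAdjoint.conjugate_nonneg (sub_nonneg.2 (hA.le_mul s))
          (hE.isStarProjection t).isSelfAdjoint
        convert h1 using 1
        simp only [sub_mul, mul_sub, smul_mul_assoc, mul_smul_comm, one_mul, mul_one, smul_sub,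
          mul_assoc, hst, hts, htt, hct, hct']
        abel
      · have h1 := IsSelfAdjoint.conjugate_nonneg (sub_nonneg.2 (hA.mul_le t))
          (IsSelfAdjoint.sub (.one _) (hE.isStarProjection s).isSelfAdjoint)
        rw [← sub_nonneg]
        convert h1 using 1
        rw [show (b - a) / 2 ^ n = t - s by linarith]
        simp only [sub_mul, mul_sub, smul_mul_assoc, mul_smul_comm, one_mul, mul_one, smul_sub,
          mul_assoc, hst, hts, hss, hcs', sub_smul]
        abel
    have h0 : 0 ≤ A - dyadicSum E a b n := hsum ▸ Finset.sum_nonneg fun i _ => (hterm i).1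
    have h1 : A - dyadicSum E a b n ≤ ((b - a) / 2 ^ n) • 1 := by
      rw [← hE.sum_increments n, Finset.smul_sum, hsum]
      exact Finset.sum_le_sum fun i _ => (hterm i).2
    rw [← Algebra.algebraMap_eq_smul_one] at h1
    exact (CStarAlgebra.norm_le_iff_le_algebraMap _ hd h0).2 h1
  rw [tendsto_iff_norm_sub_tendsto_zero]
  refine squeeze_zero (fun _ => norm_nonneg _) (fun n => (norm_sub_rev _ _).trans_le (key n)) ?_
  exact tendsto_const_nhds.div_atTop (tendsto_pow_atTop_atTop_of_one_lt (by norm_num))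

theorem eq_of_cuts (hE : IsResolution E a b) (hab : a ≤ b) {B : 𝔄} (hA : Cuts E A)
    (hB : Cuts E B) : A = B :=
  tendsto_nhds_unique (hE.tendsto_dyadicSum hab hA) (hE.tendsto_dyadicSum hab hB)

/-- The commutation clause is what later places the limit in the von Neumann algebra. -/
theorem exists_cuts (hE : IsResolution E a b) (hab : a ≤ b) :
    ∃ A, IsSelfAdjoint A ∧ Cuts E A ∧ ∀ y, (∀ s, Commute (E s) y) → Commute A y := by
  obtain ⟨A, hA⟩ := hE.exists_tendsto_dyadicSum hab
  have hcomm (y : 𝔄) (hy : ∀ s, Commute (E s) y) : Commute A y :=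
    tendsto_nhds_unique (hA.mul_const y)
      ((hA.const_mul y).congr fun n => (commute_dyadicSum hy n).eq.symm)
  refine ⟨A, ?_, ⟨fun s => hcomm _ fun t => hE.commute t s, fun s => ?_, fun s => ?_⟩, hcomm⟩
  · exact tendsto_nhds_unique (hA.star.congr fun n => hE.isSelfAdjoint_dyadicSum n) hA
  · exact le_of_tendsto' (hA.mul_const _) fun n => hE.dyadicSum_mul_le hab n s
  · have hd : Filter.Tendsto (fun n : ℕ => ((b - a) / 2 ^ n) • (1 : 𝔄)) Filter.atTop (nhds 0) := by
      rw [← zero_smul ℝ (1 : 𝔄)]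
      exact (tendsto_const_nhds.div_atTop
        (tendsto_pow_atTop_atTop_of_one_lt (by norm_num))).smul_const _
    have := (hA.add hd).mul_const (1 - E s)
    rw [add_zero] at this
    exact ge_of_tendsto' this fun n => hE.le_dyadicSum_mul hab n s

end IsResolution

/-! ### Families cutting a given element -/

namespace Cuts

variable [PartialOrder 𝔄] [StarOrderedRing 𝔄] {F : ℝ → 𝔄}

/-- Two commuting families of projections that cut the same element interlace. -/
theorem mul_eq_left (hE : ∀ s, IsStarProjection (E s)) (hF : ∀ s, IsStarProjection (F s))
    (hEA : Cuts E A) (hFA : Cuts F A) (hEF : ∀ s t, Commute (E s) (F t)) {s t : ℝ} (hst : s < t) :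
    E s * F t = E s := by
  have h1 := IsSelfAdjoint.conjugate_nonneg (sub_nonneg.2 (hEA.mul_le s))
    (hF t).one_sub.isSelfAdjoint
  have h2 := IsSelfAdjoint.conjugate_nonneg (sub_nonneg.2 (hFA.le_mul t))
    (hE s).isSelfAdjoint
  have hc : (1 - F t) * E s = E s * (1 - F t) := by rw [mul_sub, sub_mul, hEF s t]; simp
  -- For this projection `p`, the two compressed bounds read `t • p ≤ A * p ≤ s • p`; as `s < t`, it
  -- vanishes.
  have hp : IsStarProjection (E s * (1 - F t)) := (hE s).mul (hF t).one_sub hc.symm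
  have hx : (1 - F t) * (s • E s - A * E s) * (1 - F t) =
      s • (E s * (1 - F t)) - A * (E s * (1 - F t)) := by
    have hA : (1 - F t) * A = A * (1 - F t) := by rw [mul_sub, sub_mul, hFA.commute t]; simp
    have hq : (1 - F t) * (1 - F t) = 1 - F t := (hF t).one_sub.isIdempotentElem.eq
    generalize 1 - F t = q at *
    rw [mul_sub, sub_mul, ← mul_assoc, hA, mul_smul_comm, smul_mul_assoc, hc, mul_assoc A, hc,
      mul_assoc A, mul_assoc (E s), hq]
  have hy : E s * (A * (1 - F t) - t • (1 - F t)) * E s =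
      A * (E s * (1 - F t)) - t • (E s * (1 - F t)) := by
    rw [mul_sub, sub_mul, ← mul_assoc, ← hEA.commute s, mul_smul_comm, smul_mul_assoc,
      mul_assoc (E s), hc, mul_assoc A, mul_assoc A, mul_assoc (E s), hc, ← mul_assoc (E s),
      (hE s).isIdempotentElem.eq]
  rw [hx] at h1
  rw [hy] at h2
  have h3 : 0 ≤ (s - t) • (E s * (1 - F t)) := by
    have h4 := add_nonneg h1 h2
    rwa [sub_add_sub_cancel, ← sub_smul] at h4
  have h4 : (s - t) • (E s * (1 - F t)) = 0 :=
    le_antisymm (smul_nonpos_of_nonpos_of_nonneg (sub_nonpos.2 hst.le) hp.nonneg) h3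
  have h5 := (smul_eq_zero.1 h4).resolve_left (sub_ne_zero.2 hst.ne)
  rw [mul_sub, mul_one, sub_eq_zero] at h5
  exact h5.symm

theorem eq_zero_of_lt (hE : ∀ s, IsStarProjection (E s)) (hA : IsSelfAdjoint A) (hEA : Cuts E A)
    {s : ℝ} (hs : s < -‖A‖) : E s = 0 := by
  have h1 := IsSelfAdjoint.conjugate_nonneg (sub_nonneg.2 hA.neg_algebraMap_norm_le_self)
    (hE s).isSelfAdjoint
  have h2 : E s * (A - -algebraMap ℝ 𝔄 ‖A‖) * E s = A * E s + ‖A‖ • E s := by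
    rw [Algebra.algebraMap_eq_smul_one, sub_neg_eq_add, mul_add, add_mul, ← hEA.commute s,
      mul_smul_comm, smul_mul_assoc, mul_one, mul_assoc, (hE s).isIdempotentElem.eq]
  rw [h2] at h1
  have h3 : 0 ≤ (s + ‖A‖) • E s := by
    rw [add_smul]
    exact h1.trans (add_le_add_left (hEA.mul_le s) _)
  have h4 : (s + ‖A‖) • E s = 0 :=
    le_antisymm (smul_nonpos_of_nonpos_of_nonneg (by linarith) (hE s).nonneg) h3
  exact (smul_eq_zero.1 h4).resolve_left (by linarith)

/-- Reflection exchanges the two bounds, so the upper end of the family follows from the lower end.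
-/
theorem neg (hEA : Cuts E A) : Cuts (fun s => 1 - E (-s)) (-A) where
  commute s := ((Commute.one_right A).sub_right (hEA.commute _)).neg_left
  mul_le s := by
    have := neg_le_neg (hEA.le_mul (-s))
    rwa [neg_smul, neg_neg, ← neg_mul] at this
  le_mul s := by
    have := neg_le_neg (hEA.mul_le (-s))
    rwa [neg_smul, neg_neg, ← neg_mul, ← sub_sub_cancel 1 (E (-s))] at this

theorem eq_one_of_lt (hE : ∀ s, IsStarProjection (E s)) (hA : IsSelfAdjoint A) (hEA : Cuts E A)
    {s : ℝ} (hs : ‖A‖ < s) : E s = 1 := by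
  have h := eq_zero_of_lt (fun s => (hE (-s)).one_sub) hA.neg hEA.neg (s := -s)
    (by rw [norm_neg]; linarith)
  rw [neg_neg, sub_eq_zero] at h
  exact h.symm

end Cuts

end

end CStarAlgebra

/-! ### Spectral families of self-adjoint elements -/

namespace VonNeumannAlgebra

section

variable {H : Type*} [NormedAddCommGroup H] [InnerProductSpace ℂ H] [CompleteSpace H]
  {R : VonNeumannAlgebra H}

namespace Proj

theorem op_apply_of_mem_range (P : Proj R) {x : H} (hx : x ∈ (P.op.range : Submodule ℂ H)) :
    P.op x = x := by
  obtain ⟨y, rfl⟩ := hx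
  exact congrArg (fun T : H →L[ℂ] H => T y) P.isStarProjection.isIdempotentElem.eq

theorem le_iff_mul_eq_left {P Q : Proj R} : P ≤ Q ↔ P.op * Q.op = P.op := by
  have h12 : Q.op * P.op = P.op ↔ P.op * Q.op = P.op :=
    (IsStarProjection.le_tfae P.isStarProjection Q.isStarProjection).out 1 2
  rw [← h12, le_def]
  constructor
  · intro h
    ext x
    exact Q.op_apply_of_mem_range (h ⟨x, rfl⟩)
  · rintro h _ ⟨x, rfl⟩
    exact ⟨P.op x, congrArg (fun T : H →L[ℂ] H => T x) h⟩

theorem mul_eq_right {P Q : Proj R} (h : P ≤ Q) : Q.op * P.op = P.op := by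
  have h1 := congrArg star (le_iff_mul_eq_left.1 h)
  rwa [star_mul, P.isStarProjection.isSelfAdjoint.star_eq,
    Q.isStarProjection.isSelfAdjoint.star_eq] at h1

theorem op_injective : Function.Injective (fun P : Proj R => P.op) := fun P Q h => by
  cases P
  cases Q
  simpa using h

theorem bot_op : (⊥ : Proj R).op = 0 := rfl

theorem top_op : (⊤ : Proj R).op = 1 := rfl

end Proj

open DualIdeal CStarAlgebra

theorem isResolution_op {E : ℝ → Proj R} (hE : Monotone E) {a b : ℝ} (ha : E a = ⊥)
    (hb : E b = ⊤) : IsResolution (fun s => (E s).op) a b where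
  isStarProjection s := (E s).isStarProjection
  mul_eq s t := by
    rcases le_total s t with h | h
    · rw [min_eq_left h, Proj.le_iff_mul_eq_left.1 (hE h)]
    · rw [min_eq_right h, Proj.mul_eq_right (hE h)]
  eq_zero := by rw [ha, Proj.bot_op]
  eq_one := by rw [hb, Proj.top_op]

theorem exists_isResolution_op {E : ℝ → Proj R} (hE : IsBoundedSpectralFamily E) :
    ∃ a b, a ≤ b ∧ IsResolution (fun s => (E s).op) a b := by
  obtain ⟨a, ha⟩ := hE.exists_eq_bot
  obtain ⟨b, hb⟩ := hE.exists_eq_top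
  exact ⟨a, max a b, le_max_left _ _, isResolution_op hE.mono ha
    (top_le_iff.1 (hb ▸ hE.mono (le_max_right a b)))⟩

namespace SelfAdj

variable (A : SelfAdj R)

theorem mem_range_spectralFamily_iff {s : ℝ} {x : H} :
    x ∈ ((A.spectralFamily s).op.range : Submodule ℂ H) ↔
      cfc (fun t : ℝ => max (t - s) 0) A.op x = 0 := by
  have : ((A.spectralFamily s).op.range : Submodule ℂ H) =
    (cfc (fun t : ℝ => max (t - s) 0) A.op).ker := Submodule.range_starProjection _
  rw [this]
  rfl

theorem cfc_mul_spectralFamily (s : ℝ) :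
    cfc (fun t : ℝ => max (t - s) 0) A.op * (A.spectralFamily s).op = 0 := by
  ext x
  exact A.mem_range_spectralFamily_iff.1 ⟨x, rfl⟩

theorem spectralFamily_mul {s : ℝ} {T : H →L[ℂ] H}
    (hT : cfc (fun t : ℝ => max (t - s) 0) A.op * T = 0) : (A.spectralFamily s).op * T = T := by
  ext x
  refine Proj.op_apply_of_mem_range _ (A.mem_range_spectralFamily_iff.2 ?_)
  exact congrArg (fun T : H →L[ℂ] H => T x) hT

theorem mul_spectralFamily {s : ℝ} {T : H →L[ℂ] H} (hs : IsSelfAdjoint T)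
    (hT : cfc (fun t : ℝ => max (t - s) 0) A.op * T = 0) : T * (A.spectralFamily s).op = T := by
  have h := congrArg star (A.spectralFamily_mul hT)
  rwa [star_mul, hs.star_eq, (A.spectralFamily s).isStarProjection.isSelfAdjoint.star_eq] at h

/-- Such a `T` preserves the kernel onto which the spectral projection `E` projects, so `E * T * E =
T * E`; taking adjoints gives `E * T * E = E * T`. -/
theorem commute_spectralFamily {T : H →L[ℂ] H} (hs : IsSelfAdjoint T) (hT : Commute A.op T)
    (s : ℝ) : Commute T (A.spectralFamily s).op := by
  have h : (A.spectralFamily s).op * (T * (A.spectralFamily s).op) =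
      T * (A.spectralFamily s).op := A.spectralFamily_mul <| by
    rw [← mul_assoc, (hT.cfc_real _).eq, mul_assoc, cfc_mul_spectralFamily, mul_zero]
  have h' := congrArg star h
  rw [star_mul, star_mul, hs.star_eq,
    (A.spectralFamily s).isStarProjection.isSelfAdjoint.star_eq, mul_assoc, h] at h'
  exact h'

theorem cuts_spectralFamily : Cuts (fun s => (A.spectralFamily s).op) A.op := by
  -- Decompose `A = s + C - N` with `C = (A - s)⁺` and `N = (A - s)⁻`. The projection kills `C` by
  -- definition and fixes `N` because `C * N = 0`.
  have hA := A.isSelfAdjoint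
  have key (s : ℝ) : ∃ C N : H →L[ℂ] H, 0 ≤ C ∧ 0 ≤ N ∧ A.op = s • 1 + C - N ∧
      C * (A.spectralFamily s).op = 0 ∧ N * (A.spectralFamily s).op = N := by
    refine ⟨cfc (fun t : ℝ => max (t - s) 0) A.op, cfc (fun t : ℝ => max (s - t) 0) A.op,
      cfc_nonneg fun _ _ => le_max_right _ _, cfc_nonneg fun _ _ => le_max_right _ _, ?_,
      A.cfc_mul_spectralFamily s, A.mul_spectralFamily (cfc_predicate _ _) ?_⟩
    · rw [← Algebra.algebraMap_eq_smul_one, ← cfc_const s A.op, ← cfc_add .., ← cfc_sub ..]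
      conv_lhs => rw [← cfc_id ℝ A.op]
      refine cfc_congr fun t _ => ?_
      simp only [id]
      rcases le_total t s with h | h
      · rw [max_eq_right (by linarith), max_eq_left (by linarith)]; ring
      · rw [max_eq_left (by linarith), max_eq_right (by linarith)]; ring
    · rw [← cfc_mul ..]
      convert cfc_const_zero ℝ A.op using 2
      funext t
      rcases le_total t s with h | h
      · rw [max_eq_right (by linarith), zero_mul]
      · rw [max_eq_right (a := s - t) (by linarith), mul_zero]
  refine ⟨A.commute_spectralFamily hA (.refl _), fun s => ?_, fun s => ?_⟩
  · obtain ⟨C, N, hC, hN, h, hCE, hNE⟩ := key s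
    rw [h, sub_mul, add_mul, hCE, hNE, add_zero, smul_mul_assoc, one_mul]
    exact sub_le_self _ hN
  · obtain ⟨C, N, hC, hN, h, hCE, hNE⟩ := key s
    rw [h, sub_mul, add_mul, mul_sub C, mul_sub N, hCE, hNE, smul_mul_assoc, one_mul, mul_one,
      mul_one, sub_self, sub_zero, sub_zero]
    exact le_add_of_nonneg_right hC

theorem isBoundedSpectralFamily_spectralFamily :
    IsBoundedSpectralFamily A.spectralFamily where
  mono := by
    have hp (s : ℝ) := (A.spectralFamily s).isStarProjection
    refine monotone_iff_forall_lt.2 fun s t hst => Proj.le_iff_mul_eq_left.2 ?_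
    refine Cuts.mul_eq_left hp hp A.cuts_spectralFamily A.cuts_spectralFamily (fun s t => ?_) hst
    exact A.commute_spectralFamily (hp s).isSelfAdjoint (A.cuts_spectralFamily.commute s) t
  le_of_forall_gt s P h := by
    intro x hx
    rw [mem_range_spectralFamily_iff, ← norm_le_zero_iff]
    have hA := A.isSelfAdjoint
    -- Right continuity: moving the level by `r` moves the positive part by at most `r` in norm.
    have hle (r : ℝ) (hr : 0 < r) :
        ‖cfc (fun t : ℝ => max (t - s) 0) A.op x‖ ≤ r * ‖x‖ := by
      have h1 : cfc (fun t : ℝ => max (t - (s + r)) 0) A.op x = 0 :=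
        A.mem_range_spectralFamily_iff.1 (h (s + r) (by linarith) hx)
      have h2 : ‖cfc (fun t : ℝ => max (t - s) 0) A.op -
          cfc (fun t : ℝ => max (t - (s + r)) 0) A.op‖ ≤ r := by
        rw [← cfc_sub ..]
        refine norm_cfc_le hr.le fun t _ => (abs_max_sub_max_le_abs _ _ _).trans ?_
        rw [show t - s - (t - (s + r)) = r by ring, abs_of_pos hr]
      have h3 := ContinuousLinearMap.le_of_opNorm_le _ h2 x
      rwa [sub_apply, h1, sub_zero] at h3
    have hlim : Filter.Tendsto (fun r : ℝ => r * ‖x‖) (nhdsWithin 0 (Set.Ioi 0)) (nhds 0) := by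
      have : Filter.Tendsto (fun r : ℝ => r * ‖x‖) (nhds 0) (nhds (0 * ‖x‖)) :=
        Filter.tendsto_id.mul_const _
      rw [zero_mul] at this
      exact this.mono_left nhdsWithin_le_nhds
    exact ge_of_tendsto hlim (Filter.eventually_of_mem self_mem_nhdsWithin hle)
  exists_eq_bot := ⟨-‖A.op‖ - 1, Proj.op_injective <|
    A.cuts_spectralFamily.eq_zero_of_lt (fun s => (A.spectralFamily s).isStarProjection)
      A.isSelfAdjoint (by linarith)⟩
  exists_eq_top := ⟨‖A.op‖ + 1, Proj.op_injective <|
    A.cuts_spectralFamily.eq_one_of_lt (fun s => (A.spectralFamily s).isStarProjection)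
      A.isSelfAdjoint (by linarith)⟩

/-- Interlacing compares the families only at levels `s < t`; right continuity of both closes the
gap. -/
theorem eq_spectralFamily_of_cuts {E : ℝ → Proj R} (hE : IsBoundedSpectralFamily E)
    (hEA : Cuts (fun s => (E s).op) A.op) : A.spectralFamily = E := by
  have hF := A.isBoundedSpectralFamily_spectralFamily
  have hcomm (s t : ℝ) : Commute (E s).op (A.spectralFamily t).op :=
    A.commute_spectralFamily (E s).isStarProjection.isSelfAdjoint (hEA.commute s) t
  funext s
  refine le_antisymm (hE.le_of_forall_gt _ _ fun t ht => ?_)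
    (hF.le_of_forall_gt _ _ fun t ht => ?_)
  · exact Proj.le_iff_mul_eq_left.2 (Cuts.mul_eq_left
      (fun s => (A.spectralFamily s).isStarProjection) (fun s => (E s).isStarProjection)
      A.cuts_spectralFamily hEA (fun s t => (hcomm t s).symm) ht)
  · exact Proj.le_iff_mul_eq_left.2 (Cuts.mul_eq_left
      (fun s => (E s).isStarProjection) (fun s => (A.spectralFamily s).isStarProjection)
      hEA A.cuts_spectralFamily hcomm ht)

theorem exists_spectralFamily_eq {E : ℝ → Proj R} (hE : IsBoundedSpectralFamily E) :
    ∃ A : SelfAdj R, A.spectralFamily = E := by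
  obtain ⟨a, b, hab, hres⟩ := exists_isResolution_op hE
  obtain ⟨T, hT, hET, hcomm⟩ := hres.exists_cuts hab
  refine ⟨⟨T, hT, ?_⟩, eq_spectralFamily_of_cuts _ hE hET⟩
  -- Everything commuting with all `E s` commutes with `T`, so `T` lies in the double commutant.
  rw [← R.commutant_commutant, mem_commutant_iff]
  exact fun y hy => (hcomm y fun s => mem_commutant_iff.1 hy _ (E s).mem).eq.symm

theorem spectralFamily_injective :
    Function.Injective (spectralFamily : SelfAdj R → ℝ → Proj R) := by
  intro A B h
  obtain ⟨a, b, hab, hres⟩ := exists_isResolution_op A.isBoundedSpectralFamily_spectralFamily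
  have := hres.eq_of_cuts hab A.cuts_spectralFamily (h ▸ B.cuts_spectralFamily)
  cases A
  cases B
  simpa using this

theorem observableFunction_eq_lowerCut : A.observableFunction = lowerCut A.spectralFamily := rfl

end SelfAdj

end

end VonNeumannAlgebra

theorem theorem2p13 {H : Type*} [NormedAddCommGroup H] [InnerProductSpace ℂ H] [CompleteSpace H]
    (R : VonNeumannAlgebra H) :
    (∀ A : R.SelfAdj, DualIdeal.IsAbstractObservable A.observableFunction) ∧
    ∀ f : DualIdeal R.Proj → ℝ, DualIdeal.IsAbstractObservable f →
      ∃! A : R.SelfAdj, f = A.observableFunction := by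
  refine ⟨fun A => A.isBoundedSpectralFamily_spectralFamily.isAbstractObservable_lowerCut,
    fun f hf => ?_⟩
  obtain ⟨A, hA⟩ := VonNeumannAlgebra.SelfAdj.exists_spectralFamily_eq
    hf.isBoundedSpectralFamily_levelSup
  have hfA : f = A.observableFunction := by
    rw [A.observableFunction_eq_lowerCut, hA, hf.lowerCut_levelSup]
  refine ⟨A, hfA, fun B hB => VonNeumannAlgebra.SelfAdj.spectralFamily_injective ?_⟩
  exact B.isBoundedSpectralFamily_spectralFamily.eq_of_lowerCut_eq
    A.isBoundedSpectralFamily_spectralFamily (hB.symm.trans hfA)
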